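/- Let $F$ be an algebraically closed field. For integers $1\le r\le m\le n$ and $k\ge 1$ let $X(t)=(x_{i,j}(t))$, $x_{i,j}(t)=\sum_{l=0}^{k-1}x_{i,j}^{(l)}t^l$, be the generic $m\times n$ matrix over $F[t]/(t^k)$, let $\mathcal I^{m,n}_{r,k}\subset S=F[x_{i,j}^{(l)}]$ be the ideal generated by the coefficients of $t^l$ $(0\le l<k)$ of all $r\times r$ minors of $X(t)$, and let $\mathcal Z^{m,n}_{r,k}\subseteq\mathbf A^{mnk}$ be its zero set. Let $Z_0$ be the union of the zero sets of those minimal primes of $\mathcal I^{m,n}_{r,k}$ that do not contain some $x_{i,j}^{(0)}$, and let $Z_1$ be the subvariety of $\mathcal Z^{m,n}_{r,k}$ where all $x_{i,j}^{(0)}$ are zero. Proposition. Suppose $k<r$ (so $r\ge 2$). Then $Z_1\subseteq Z_0$. The irreducible components of $\mathcal Z^{m,n}_{r,k}$ and their codimensions in $\mathbf A^{mnk}$ are hence determined by the irreducible components of $\mathcal Z^{m-1,n-1}_{r-1,k}$ and their codimensions in $\mathbf A^{(m-1)(n-1)k}$, as follows. For $x\in\mathbf A^{mnk}$ with $x_{m,n}^{(0)}\ne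 0$ let $\sigma(x)\in\mathbf A^{(m-1)(n-1)k}$ be the $(m-1)\times(n-1)$ matrix over $F[t]/(t^k)$ with entries $x_{i,j}(t)-x_{m,j}(t)\,x_{i,n}(t)\,x_{m,n}(t)^{-1}$, and for $C\subseteq\mathbf A^{(m-1)(n-1)k}$ let $\Lambda(C)$ be the Zariski closure in $\mathbf A^{mnk}$ of $\{x : x_{m,n}^{(0)}\neq 0,\ \sigma(x)\in C\}$. Then $C\mapsto\Lambda(C)$ is a bijection from the set of irreducible components of $\mathcal Z^{m-1,n-1}_{r-1,k}$ onto the set of irreducible components of $\mathcal Z^{m,n}_{r,k}$, and the codimension of $\Lambda(C)$ in $\mathbf A^{mnk}$ equals the codimension of $C$ in $\mathbf A^{(m-1)(n-1)k}$. -/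

import Mathlib

namespace TruncDet

/-- The coordinates `x_{i,j}^{(l)}` of an `m × n` matrix over `F[t]/(t^k)` (indices start at `0`). -/
abbrev Idx (m n k : ℕ) : Type := Fin m × Fin n × Fin k

/-- The affine space `𝐀^{mnk}` over `F`. -/
abbrev Aff (F : Type*) (m n k : ℕ) : Type _ := Idx m n k → F

/-- The Zariski topology on the affine space `F^σ`, pulled back from the prime spectrum of the
polynomial ring. Its closed sets are the zero loci of ideals, see `isClosed_zariski_iff`. -/
@[reducible] noncomputable def zariski (F σ : Type*) [Field F] : TopologicalSpace (σ → F) :=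
  TopologicalSpace.induced
    (MvPolynomial.pointToPoint : (σ → F) → PrimeSpectrum (MvPolynomial σ F)) inferInstance

theorem isClosed_zariski_iff {F σ : Type*} [Field F] (V : Set (σ → F)) :
    @IsClosed _ (zariski F σ) V ↔ ∃ I : Ideal (MvPolynomial σ F), V = MvPolynomial.zeroLocus F I := by
  have key : ∀ I : Ideal (MvPolynomial σ F),
      (MvPolynomial.pointToPoint : (σ → F) → PrimeSpectrum (MvPolynomial σ F)) ⁻¹'
        PrimeSpectrum.zeroLocus (I : Set (MvPolynomial σ F)) = MvPolynomial.zeroLocus F I := by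
    intro I
    ext x
    simp only [Set.mem_preimage, PrimeSpectrum.mem_zeroLocus, MvPolynomial.mem_zeroLocus_iff]
    constructor
    · intro h p hp
      exact h hp x rfl
    · intro h p hp y hy
      rw [Set.mem_singleton_iff.1 hy]
      exact h p hp
  unfold zariski
  rw [isClosed_induced_iff]
  constructor
  · rintro ⟨T, hT, rfl⟩
    obtain ⟨I, rfl⟩ := (PrimeSpectrum.isClosed_iff_zeroLocus_ideal T).1 hT
    exact ⟨I, key I⟩
  · rintro ⟨I, rfl⟩
    exact ⟨_, PrimeSpectrum.isClosed_zeroLocus _, key I⟩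

/-- The irreducible components of a subset `V` of affine space: its maximal irreducible subsets
in the Zariski topology. -/
def components {F σ : Type*} [Field F] (V : Set (σ → F)) : Set (Set (σ → F)) :=
  {C | Maximal (fun W : Set (σ → F) => W ⊆ V ∧ @IsIrreducible _ (zariski F σ) W) C}

/-- The codimension in `F^σ` of an irreducible closed set `C`: the height of its ideal. -/
noncomputable def codim {F σ : Type*} [Field F] (C : Set (σ → F)) : ℕ∞ :=
  (MvPolynomial.vanishingIdeal F C).height

/-- The generic matrix `X(t)`, with entries `∑_{l<k} x_{i,j}^{(l)} t^l`. Its entries are taken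
in `S[t]` with `S = F[x_{i,j}^{(l)}]`, as representatives of their classes in `S[t]/(t^k)`. -/
noncomputable def genericMatrix (F : Type*) [Field F] (m n k : ℕ) :
    Matrix (Fin m) (Fin n) (Polynomial (MvPolynomial (Idx m n k) F)) :=
  Matrix.of fun i j => ∑ l : Fin k,
    Polynomial.C (MvPolynomial.X (i, j, l)) * Polynomial.X ^ (l : ℕ)

/-- The ideal `I^{m,n}_{r,k}` generated by the coefficients of `t^l`, `0 ≤ l < k`, of all the
`r × r` minors of the generic matrix. (For `l < k` the coefficient of `t^l` is well defined on
classes modulo `t^k`.) -/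
noncomputable def detIdeal (F : Type*) [Field F] (m n r k : ℕ) :
    Ideal (MvPolynomial (Idx m n k) F) :=
  Ideal.span {p | ∃ (a : Fin r ↪o Fin m) (b : Fin r ↪o Fin n) (l : Fin k),
    p = (((genericMatrix F m n k).submatrix a b).det).coeff (l : ℕ)}

/-- The variety `Z^{m,n}_{r,k}`. -/
noncomputable def detVariety (F : Type*) [Field F] (m n r k : ℕ) : Set (Aff F m n k) :=
  MvPolynomial.zeroLocus F (detIdeal F m n r k)

/-- `Z_0`: the union of the zero sets of those minimal primes of `I^{m,n}_{r,k}` that do not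
contain some degree zero variable `x_{i,j}^{(0)}`. -/
noncomputable def detVarietyZero (F : Type*) [Field F] (m n r k : ℕ) : Set (Aff F m n k) :=
  ⋃ P ∈ {P : Ideal (MvPolynomial (Idx m n k) F) | P ∈ (detIdeal F m n r k).minimalPrimes ∧
    ∃ (i : Fin m) (j : Fin n) (l : Fin k), (l : ℕ) = 0 ∧ MvPolynomial.X (i, j, l) ∉ P},
    MvPolynomial.zeroLocus F P

/-- `Z_1`: the subvariety of `Z^{m,n}_{r,k}` where all the `x_{i,j}^{(0)}` are zero. -/
noncomputable def detVarietyOne (F : Type*) [Field F] (m n r k : ℕ) : Set (Aff F m n k) :=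
  {x | x ∈ detVariety F m n r k ∧
    ∀ (i : Fin m) (j : Fin n) (l : Fin k), (l : ℕ) = 0 → x (i, j, l) = 0}

/-- The entry `x_{i,j}(t)` of the matrix `x`, as a power series representing an element of
`F[t]/(t^k) = F⟦t⟧/(t^k)`. -/
noncomputable def entry {F : Type*} [Field F] {m n k : ℕ} (x : Aff F m n k)
    (i : Fin m) (j : Fin n) : PowerSeries F :=
  PowerSeries.mk fun l => if h : l < k then x (i, j, ⟨l, h⟩) else 0

/-- The `m × n` matrix over `F[t]/(t^k)` with entries
`x_{i,j} - x_{last,j} x_{i,last} x_{last,last}⁻¹`, obtained from an `(m+1) × (n+1)` matrix `x` by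
clearing the last column with the help of the last row and deleting both. It is meaningful where
`x_{last,last}^{(0)} ≠ 0`. -/
noncomputable def schur {F : Type*} [Field F] {m n k : ℕ} (x : Aff F (m + 1) (n + 1) k) :
    Aff F m n k :=
  fun q => PowerSeries.coeff (q.2.2 : ℕ)
    (entry x q.1.castSucc q.2.1.castSucc
      - entry x (Fin.last m) q.2.1.castSucc * entry x q.1.castSucc (Fin.last n)
        * (entry x (Fin.last m) (Fin.last n))⁻¹)

/-- The Zariski closure of the set of all `(m+1) × (n+1)` matrices over `F[t]/(t^k)` whose last
entry is invertible and whose reduction `schur x` lies in `C`. -/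
noncomputable def lift {F : Type*} [Field F] {m n k : ℕ} (C : Set (Aff F m n k)) :
    Set (Aff F (m + 1) (n + 1) k) :=
  @closure _ (zariski F (Idx (m + 1) (n + 1) k))
    {x | PowerSeries.constantCoeff (entry x (Fin.last m) (Fin.last n)) ≠ 0 ∧ schur x ∈ C}

end TruncDet

/-! Write `Z` for the variety of matrices of size `(m+1) × (n+1)` with vanishing minors of size
`r+1`, `Z'` for the one of size `m × n` with minors of size `r`, and `U` for the open set where the
corner coefficient `x_{last,last}^{(0)}` is nonzero. The proof rests on two facts.

Over `U` the corner is a unit of `F[t]/(t^k)`, so row operations clear the last column and give `Z ∩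
U = schur⁻¹(Z') ∩ U` (`schur_mem_detVariety_iff`). Moreover `schur` is an automorphism of `U`
(`shear (-1)`) followed by a coordinate projection. Hence, for `C` closed and irreducible,
`schur⁻¹(C) ∩ U` is irreducible, is closed in `U` and has the codimension of `C`
(`isIrreducible_lift`, `codim_lift`).

The set `Z ∩ U` is dense in `Z` (`detVariety_subset_closure`), and only here is `k ≤ r` needed. A
point with a nonzero degree zero coefficient is moved into `U` along a curve of row and column
operations. If all degree zero coefficients vanish, every entry is divisible by `t`, and perturbing
the corner alone keeps the point in `Z` because `t ^ r = 0`.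

By density all of `Z`, not only `Z_1`, lies in `Z_0`, and every component of `Z` is the closure of
its trace on `U`. The components therefore correspond to those of `Z'`. -/

namespace TruncDet

open MvPolynomial

attribute [local instance] zariski

/-! ### Zariski topology on affine space and regular functions on a principal open set -/

section Zariski

variable {F σ τ : Type*} [Field F]

theorem isInducing_pointToPoint :
    Topology.IsInducing (pointToPoint : (σ → F) → PrimeSpectrum (MvPolynomial σ F)) := ⟨rfl⟩

theorem isClosed_zeroLocus (I : Ideal (MvPolynomial σ F)) :
    IsClosed (zeroLocus F I : Set (σ → F)) :=
  (isClosed_zariski_iff _).2 ⟨I, rfl⟩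

theorem closure_eq_zeroLocus (B : Set (σ → F)) :
    closure B = zeroLocus F (vanishingIdeal F B) := by
  apply subset_antisymm
  · exact closure_minimal (zeroLocus_vanishingIdeal_le B) (isClosed_zeroLocus _)
  · obtain ⟨I, hI⟩ := (isClosed_zariski_iff (closure B)).1 isClosed_closure
    rw [hI]
    apply zeroLocus_anti_mono
    rw [← le_zeroLocus_iff_le_vanishingIdeal, ← hI]
    exact subset_closure

theorem mem_closure_iff_forall_aeval {B : Set (σ → F)} {x : σ → F} :
    x ∈ closure B ↔ ∀ p : MvPolynomial σ F, (∀ y ∈ B, aeval y p = 0) → aeval x p = 0 := by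
  rw [closure_eq_zeroLocus]; rfl

theorem isOpen_aeval_ne_zero (g : MvPolynomial σ F) : IsOpen {x : σ → F | aeval x g ≠ 0} := by
  have : {x : σ → F | aeval x g ≠ 0} = (zeroLocus F (Ideal.span {g}))ᶜ := by
    ext x; simp [zeroLocus_span]
  rw [this]
  exact (isClosed_zeroLocus _).isOpen_compl

theorem isIrreducible_iff_isPrime_vanishingIdeal {B : Set (σ → F)} :
    IsIrreducible B ↔ (vanishingIdeal F B).IsPrime := by
  rw [← vanishingIdeal_pointToPoint, ← PrimeSpectrum.isIrreducible_iff_vanishingIdeal_isPrime]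
  constructor
  · exact fun h => h.image _ isInducing_pointToPoint.continuous.continuousOn
  · refine fun h => ⟨h.1.of_image, ?_⟩
    rintro U V hU hV ⟨x, hx, hxU⟩ ⟨y, hy, hyV⟩
    obtain ⟨U, hU', rfl⟩ := isInducing_pointToPoint.isOpen_iff.1 hU
    obtain ⟨V, hV', rfl⟩ := isInducing_pointToPoint.isOpen_iff.1 hV
    obtain ⟨_, ⟨z, hz, rfl⟩, hz'⟩ := h.2 U V hU' hV' ⟨_, ⟨x, hx, rfl⟩, hxU⟩ ⟨_, ⟨y, hy, rfl⟩, hyV⟩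
    exact ⟨z, hz, hz'⟩

theorem isIrreducible_univ_zariski [Infinite F] : IsIrreducible (Set.univ : Set (σ → F)) := by
  rw [isIrreducible_iff_isPrime_vanishingIdeal]
  have : vanishingIdeal F (Set.univ : Set (σ → F)) = ⊥ := by
    refine eq_bot_iff.2 fun p hp => ?_
    refine MvPolynomial.funext fun x => ?_
    simpa using hp x trivial
  rw [this]
  exact Ideal.isPrime_bot

theorem noetherianSpace_zariski [Finite σ] : TopologicalSpace.NoetherianSpace (σ → F) :=
  isInducing_pointToPoint.noetherianSpace

/-- The functions on `F^σ` that are, where `g ≠ 0`, a polynomial divided by a power of `g`. -/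
def regularOn (g : MvPolynomial σ F) : Subalgebra F ((σ → F) → F) where
  carrier := {h | ∃ (e : ℕ) (P : MvPolynomial σ F),
    ∀ x, aeval x g ≠ 0 → h x * (aeval x g) ^ e = aeval x P}
  mul_mem' := by
    rintro a b ⟨e, P, h⟩ ⟨e', P', h'⟩
    refine ⟨e + e', P * P', fun x hx => ?_⟩
    rw [map_mul, ← h x hx, ← h' x hx, Pi.mul_apply]
    ring
  add_mem' := by
    rintro a b ⟨e, P, h⟩ ⟨e', P', h'⟩
    refine ⟨e + e', P * g ^ e' + P' * g ^ e, fun x hx => ?_⟩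
    rw [map_add, map_mul, map_mul, ← h x hx, ← h' x hx, Pi.add_apply, map_pow, map_pow]
    ring
  algebraMap_mem' c := ⟨0, C c, fun x _ => by simp⟩

theorem coord_mem_regularOn (g : MvPolynomial σ F) (i : σ) :
    (fun x : σ → F => x i) ∈ regularOn g :=
  ⟨0, X i, fun x _ => by simp⟩

theorem inv_mem_regularOn (g : MvPolynomial σ F) :
    (fun x : σ → F => (aeval x g)⁻¹) ∈ regularOn g :=
  ⟨1, 1, fun x hx => by rw [pow_one, inv_mul_cancel₀ hx, map_one]⟩

theorem const_mem_regularOn (g : MvPolynomial σ F) (c : F) :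
    (fun _ : σ → F => c) ∈ regularOn g :=
  (regularOn g).algebraMap_mem c

theorem aeval_comp_mem_regularOn {g : MvPolynomial σ F} {f : (σ → F) → (τ → F)}
    (hf : ∀ i, (fun x => f x i) ∈ regularOn g) (p : MvPolynomial τ F) :
    (fun x => aeval (f x) p) ∈ regularOn g := by
  induction p using MvPolynomial.induction_on with
  | C a => simpa using const_mem_regularOn g a
  | add p q hp hq =>
    simp only [map_add]
    exact (regularOn g).add_mem hp hq
  | mul_X p i hp =>
    simp only [map_mul, aeval_X]
    exact (regularOn g).mul_mem hp (hf i)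

/-- Pulling back an equation of a closed set and multiplying by a power of `g` gives a polynomial.
It vanishes on the closure of the preimage, and where `g ≠ 0` the power of `g` can be cancelled
again. -/
theorem continuousOn_of_mem_regularOn {g : MvPolynomial σ F} {f : (σ → F) → (τ → F)}
    (hf : ∀ i, (fun x => f x i) ∈ regularOn g) :
    ContinuousOn f {x | aeval x g ≠ 0} := by
  rw [continuousOn_iff_isClosed]
  intro t ht
  refine ⟨closure (f ⁻¹' t ∩ {x | aeval x g ≠ 0}), isClosed_closure, subset_antisymm ?_ ?_⟩
  · exact Set.subset_inter subset_closure Set.inter_subset_right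
  · rintro x ⟨hx, hxg⟩
    refine ⟨?_, hxg⟩
    obtain ⟨I, rfl⟩ := (isClosed_zariski_iff t).1 ht
    intro p hp
    obtain ⟨e, P, hP⟩ := aeval_comp_mem_regularOn hf p
    have h0 : aeval x P = 0 := mem_closure_iff_forall_aeval.1 hx P fun y ⟨hy, hyg⟩ => by
      rw [← hP y hyg]
      exact mul_eq_zero_of_left (hy p hp) _
    rw [← hP x hxg] at h0
    exact (mul_eq_zero.1 h0).resolve_right (pow_ne_zero _ hxg)

theorem continuous_of_mem_regularOn_one {f : (σ → F) → (τ → F)}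
    (hf : ∀ i, (fun x => f x i) ∈ regularOn (1 : MvPolynomial σ F)) : Continuous f := by
  have := continuousOn_of_mem_regularOn hf
  rw [← continuousOn_univ]
  simpa using this

/-- A point of a polynomial curve lies in the closure of `B` if the general point of the curve
lies in `B`. -/
theorem mem_closure_of_curve [Infinite F] {B : Set (σ → F)} (c : σ → Polynomial F)
    {h : Polynomial F} (hh : h ≠ 0) (hB : ∀ s, h.eval s ≠ 0 → (fun i => (c i).eval s) ∈ B) (s : F) :
    (fun i => (c i).eval s) ∈ closure B := by
  rw [mem_closure_iff_forall_aeval]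
  intro p hp
  have key : ∀ s, aeval (fun i => (c i).eval s) p = (aeval c p : Polynomial F).eval s := by
    intro s
    have := MvPolynomial.map_aeval c (Polynomial.evalRingHom s) p
    rw [Polynomial.coe_evalRingHom] at this
    rw [this, MvPolynomial.aeval_def, MvPolynomial.eval₂Hom]
    simp only [RingHom.coe_mk, MonoidHom.coe_mk, OneHom.coe_mk]
    congr 1
    ext a
    simp
  -- The product vanishes at every `s`, and `F` is infinite.
  have h0 : (aeval c p : Polynomial F) * h = 0 := by
    refine Polynomial.funext fun s => ?_
    by_cases hs : h.eval s = 0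
    · simp [hs]
    · rw [Polynomial.eval_mul, ← key, hp _ (hB s hs)]; simp
  rw [key, (mul_eq_zero.1 h0).resolve_right hh, Polynomial.eval_zero]

end Zariski

/-! ### Cylinders over a closed set: irreducibility and codimension -/

section Projection

variable {F σ τ : Type*} [Field F] {ι : σ → τ}

theorem continuous_comp_right (ι : σ → τ) :
    Continuous (fun x : τ → F => (x ∘ ι : σ → F)) :=
  continuous_of_mem_regularOn_one fun i => coord_mem_regularOn _ (ι i)

theorem continuous_extend_left (hι : ι.Injective) (z : τ → F) :
    Continuous (fun y : σ → F => (Function.extend ι y z : τ → F)) := by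
  refine continuous_of_mem_regularOn_one fun i => ?_
  by_cases h : ∃ a, ι a = i
  · obtain ⟨a, rfl⟩ := h
    simpa only [hι.extend_apply] using coord_mem_regularOn _ a
  · simpa only [Function.extend_apply' _ _ _ h] using const_mem_regularOn _ _

theorem continuous_extend_right (hι : ι.Injective) (y : σ → F) :
    Continuous (fun z : τ → F => (Function.extend ι y z : τ → F)) := by
  refine continuous_of_mem_regularOn_one fun i => ?_
  by_cases h : ∃ a, ι a = i
  · obtain ⟨a, rfl⟩ := h
    simpa only [hι.extend_apply] using const_mem_regularOn _ _
  · simpa only [Function.extend_apply' _ _ _ h] using coord_mem_regularOn _ i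

omit [Field F] in
theorem extend_comp_self (ι : σ → τ) (hι : ι.Injective) (x : τ → F) :
    Function.extend ι (x ∘ ι) x = x := by
  ext i
  by_cases h : ∃ a, ι a = i
  · obtain ⟨a, rfl⟩ := h
    rw [hι.extend_apply]; rfl
  · rw [Function.extend_apply' _ _ _ h]

/-- The projection is open, since overwriting the coordinates in the range of `ι` gives a continuous
section through each point. Its fibres are images of an affine space, hence irreducible. -/
theorem isIrreducible_preimage_comp [Infinite F] (hι : ι.Injective) {C : Set (σ → F)}
    (hC : IsIrreducible C) : IsIrreducible ((fun x : τ → F => (x ∘ ι : σ → F)) ⁻¹' C) := by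
  refine hC.preimage_of_isPreirreducible_fiber _ ?_ ?_ ?_
  · refine IsOpenMap.of_sections fun x => ⟨fun y => Function.extend ι y x,
      (continuous_extend_left hι x).continuousAt, extend_comp_self ι hι x, fun y => ?_⟩
    exact Function.extend_comp hι y x
  · intro y
    have : (fun x : τ → F => (x ∘ ι : σ → F)) ⁻¹' {y} =
        (fun z : τ → F => (Function.extend ι y z : τ → F)) '' Set.univ := by
      ext x
      constructor
      · rintro rfl
        exact ⟨x, trivial, extend_comp_self ι hι x⟩
      · rintro ⟨z, -, rfl⟩
        exact Function.extend_comp hι y z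
    rw [this]
    exact (isIrreducible_univ_zariski.image _ (continuous_extend_right hι y).continuousOn).2
  · obtain ⟨y, hy⟩ := hC.1
    exact ⟨y, hy, Function.extend ι y fun _ => 0, Function.extend_comp hι y _⟩

theorem comap_rename_vanishingIdeal (hι : ι.Injective) (C : Set (σ → F)) :
    (vanishingIdeal F ((fun x : τ → F => (x ∘ ι : σ → F)) ⁻¹' C)).comap (rename ι) =
      vanishingIdeal F C := by
  ext p
  simp only [Ideal.mem_comap, mem_vanishingIdeal_iff, aeval_rename, Set.mem_preimage]
  refine ⟨fun h y hy => ?_, fun h x hx => h _ hx⟩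
  have := h (Function.extend ι y fun _ => 0)
  rw [Function.extend_comp hι] at this
  exact this hy

theorem vanishingIdeal_preimage_comp [IsAlgClosed F] [Finite τ] {C : Set (σ → F)}
    (hC : IsClosed C) :
    vanishingIdeal F ((fun x : τ → F => (x ∘ ι : σ → F)) ⁻¹' C) =
      ((vanishingIdeal F C).map (rename ι : MvPolynomial σ F →ₐ[F] _)).radical := by
  rw [← vanishingIdeal_zeroLocus_eq_radical (K := F)]
  congr 1
  rw [Ideal.map, zeroLocus_span]
  ext x
  have h : C = zeroLocus F (vanishingIdeal F C) := by rw [← closure_eq_zeroLocus, hC.closure_eq]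
  conv_lhs => rw [h, Set.mem_preimage, mem_zeroLocus_iff]
  simp [eval_rename]

theorem isIrreducible_zeroLocus [IsAlgClosed F] [Finite σ] (P : Ideal (MvPolynomial σ F))
    [P.IsPrime] : IsIrreducible (zeroLocus F P : Set (σ → F)) := by
  rw [isIrreducible_iff_isPrime_vanishingIdeal, IsPrime.vanishingIdeal_zeroLocus]
  infer_instance

/-- For `≤`, the ideal of `C` is minimal over as many elements as its height; the ideal of the
cylinder is minimal over their images, so Krull's height theorem applies. For `≥`, chains of primes
lift to chains of ideals of cylinders, and contraction along `rename ι` shows that they stay strict.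
-/
theorem codim_preimage_comp [IsAlgClosed F] [Finite σ] [Finite τ] (hι : ι.Injective)
    {C : Set (σ → F)} (hC : IsIrreducible C) (hC' : IsClosed C) :
    codim ((fun x : τ → F => (x ∘ ι : σ → F)) ⁻¹' C) = codim C := by
  have hinf : Infinite F := IsAlgClosed.instInfinite
  have hP := isIrreducible_iff_isPrime_vanishingIdeal.1 hC
  have hQ := isIrreducible_iff_isPrime_vanishingIdeal.1 (isIrreducible_preimage_comp hι hC)
  unfold codim
  apply le_antisymm
  · obtain ⟨s, hs, hcard⟩ := (vanishingIdeal F C).exists_finset_card_eq_height_of_isNoetherianRing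
    rw [← hcard]
    classical
    refine (Ideal.height_le_card_of_mem_minimalPrimes_span_finset
      (s := s.image (rename ι)) ⟨⟨hQ, ?_⟩, ?_⟩).trans (by exact_mod_cast Finset.card_image_le)
    · rw [Ideal.span_le, Finset.coe_image, Set.image_subset_iff]
      refine fun p hp => ?_
      have : p ∈ vanishingIdeal F C := hs.1.2 (Ideal.subset_span hp)
      rw [← comap_rename_vanishingIdeal hι] at this
      exact this
    · rintro Q' ⟨hQ', hsQ'⟩ hle
      have h1 : Q'.comap (rename ι : MvPolynomial σ F →ₐ[F] _) ≤ vanishingIdeal F C := by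
        rw [← comap_rename_vanishingIdeal hι]
        exact Ideal.comap_mono hle
      have h2 := hs.2 ⟨Ideal.comap_isPrime _ Q', Ideal.span_le.2 fun p hp => hsQ'
        (Ideal.subset_span (Finset.mem_coe.2 (Finset.mem_image_of_mem _ hp)))⟩ h1
      rw [vanishingIdeal_preimage_comp hC']
      exact hQ'.radical_le_iff.2 (Ideal.map_le_iff_le_comap.2 h2)
  · let e : PrimeSpectrum (MvPolynomial σ F) → PrimeSpectrum (MvPolynomial τ F) := fun p =>
      ⟨vanishingIdeal F ((fun x : τ → F => (x ∘ ι : σ → F)) ⁻¹' zeroLocus F p.asIdeal),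
        isIrreducible_iff_isPrime_vanishingIdeal.1
          (isIrreducible_preimage_comp hι (isIrreducible_zeroLocus _))⟩
    have he : ∀ p, (e p).asIdeal.comap (rename ι : MvPolynomial σ F →ₐ[F] _) = p.asIdeal :=
      fun p => by rw [comap_rename_vanishingIdeal hι, IsPrime.vanishingIdeal_zeroLocus]
    have hmono : StrictMono e := by
      refine Monotone.strictMono_of_injective (fun p q hpq => ?_) fun p q hpq => ?_
      · exact vanishingIdeal_anti_mono (Set.preimage_mono (zeroLocus_anti_mono hpq))
      · ext1
        rw [← he p, hpq, he]
    have := Order.height_le_height_apply_of_strictMono e hmono ⟨_, hP⟩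
    rw [← PrimeSpectrum.height_eq_orderHeight, ← PrimeSpectrum.height_eq_orderHeight] at this
    rwa [show (e ⟨_, hP⟩).asIdeal =
      vanishingIdeal F ((fun x : τ → F => (x ∘ ι : σ → F)) ⁻¹' C) by
        simp only [e, ← closure_eq_zeroLocus, hC'.closure_eq]] at this

end Projection

/-! ### Invariance of codimension under automorphisms of a principal open set -/

section Codim

variable {F σ : Type*} [Field F]

theorem isIrreducible_inter_of_isOpen {X : Type*} [TopologicalSpace X] {S U : Set X}
    (hS : IsIrreducible S) (hU : IsOpen U) (h : (S ∩ U).Nonempty) : IsIrreducible (S ∩ U) := by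
  rw [← isIrreducible_iff_closure]
  have : closure (S ∩ U) = closure S := subset_antisymm (closure_mono Set.inter_subset_left)
    (closure_minimal (subset_closure_inter_of_isPreirreducible_of_isOpen hS.2 hU h)
      isClosed_closure)
  rw [this]
  exact hS.closure

theorem vanishingIdeal_closure (B : Set (σ → F)) :
    vanishingIdeal F (closure B) = vanishingIdeal F B := by
  rw [closure_eq_zeroLocus]
  exact le_antisymm (vanishingIdeal_anti_mono (zeroLocus_vanishingIdeal_le B))
    (le_vanishingIdeal_zeroLocus _)

/-- If `p` vanishes on this set, then `p * g` vanishes on the zero locus of `P`, so it lies in `P`,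
which does not contain `g`. -/
theorem vanishingIdeal_zeroLocus_inter [IsAlgClosed F] [Finite σ] {g : MvPolynomial σ F}
    (P : Ideal (MvPolynomial σ F)) [hP : P.IsPrime] (hg : g ∉ P) :
    vanishingIdeal F (zeroLocus F P ∩ {x : σ → F | aeval x g ≠ 0}) = P := by
  refine le_antisymm (fun p hp => ?_) ?_
  · have : p * g ∈ vanishingIdeal F (zeroLocus F P : Set (σ → F)) := fun x hx => by
      rw [map_mul]
      by_cases hxg : aeval x g = 0
      · rw [hxg, mul_zero]
      · rw [hp x ⟨hx, hxg⟩, zero_mul]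
    rw [IsPrime.vanishingIdeal_zeroLocus] at this
    exact (hP.mem_or_mem this).resolve_right hg
  · exact (le_vanishingIdeal_zeroLocus P).trans (vanishingIdeal_anti_mono Set.inter_subset_left)

theorem nonempty_zeroLocus_inter [IsAlgClosed F] [Finite σ] {g : MvPolynomial σ F}
    (P : Ideal (MvPolynomial σ F)) [hP : P.IsPrime] (hg : g ∉ P) :
    (zeroLocus F P ∩ {x : σ → F | aeval x g ≠ 0}).Nonempty := by
  rw [Set.nonempty_iff_ne_empty]
  intro h
  have := vanishingIdeal_zeroLocus_inter P hg
  rw [h, vanishingIdeal_empty] at this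
  exact hP.ne_top this.symm

theorem closure_inter_subset_of_continuousOn {X Y : Type*} [TopologicalSpace X]
    [TopologicalSpace Y] {f : X → Y} {U : Set X} (hf : ContinuousOn f U) {t : Set Y}
    (ht : IsClosed t) : closure (f ⁻¹' t ∩ U) ∩ U = f ⁻¹' t ∩ U := by
  obtain ⟨u, hu, h⟩ := continuousOn_iff_isClosed.1 hf t ht
  refine subset_antisymm (fun x ⟨hx, hxU⟩ => ?_)
    (Set.subset_inter subset_closure Set.inter_subset_right)
  rw [h]
  rw [h] at hx
  exact ⟨closure_minimal Set.inter_subset_left hu hx, hxU⟩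

/-- The action on primes not containing `g` of an automorphism of the principal open set
`g ≠ 0`. -/
noncomputable def primeImage [IsAlgClosed F] [Finite σ] {g : MvPolynomial σ F}
    {f : (σ → F) → (σ → F)} (hf : ∀ i, (fun x => f x i) ∈ regularOn g)
    (hg : ∀ x, aeval (f x) g = aeval x g)
    (P : {P : PrimeSpectrum (MvPolynomial σ F) // g ∉ P.asIdeal}) :
    {P : PrimeSpectrum (MvPolynomial σ F) // g ∉ P.asIdeal} :=
  ⟨⟨vanishingIdeal F (f '' (zeroLocus F P.1.asIdeal ∩ {x | aeval x g ≠ 0})),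
    isIrreducible_iff_isPrime_vanishingIdeal.1
      ((isIrreducible_inter_of_isOpen (isIrreducible_zeroLocus _) (isOpen_aeval_ne_zero g)
        (nonempty_zeroLocus_inter _ P.2)).image f
          ((continuousOn_of_mem_regularOn hf).mono Set.inter_subset_right))⟩, by
    obtain ⟨x, hx, hxg⟩ := nonempty_zeroLocus_inter _ P.2
    exact fun h => hxg (by rw [← hg]; exact h _ ⟨x, ⟨hx, hxg⟩, rfl⟩)⟩

theorem image_inter_eq {g : MvPolynomial σ F} {f f' : (σ → F) → (σ → F)}
    (hg : ∀ x, aeval (f x) g = aeval x g) (hl : Function.LeftInverse f' f)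
    (hr : Function.RightInverse f' f) (t : Set (σ → F)) :
    f '' (t ∩ {x | aeval x g ≠ 0}) = f' ⁻¹' t ∩ {x | aeval x g ≠ 0} := by
  ext y
  constructor
  · rintro ⟨x, ⟨hx, hxg⟩, rfl⟩
    refine ⟨?_, ?_⟩
    · rwa [Set.mem_preimage, hl]
    · rwa [Set.mem_ofPred_eq, hg]
  · rintro ⟨hy, hyg⟩
    refine ⟨f' y, ⟨hy, ?_⟩, hr y⟩
    rwa [Set.mem_ofPred_eq, ← hg, hr]

theorem primeImage_primeImage [IsAlgClosed F] [Finite σ] {g : MvPolynomial σ F}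
    {f f' : (σ → F) → (σ → F)} (hf : ∀ i, (fun x => f x i) ∈ regularOn g)
    (hf' : ∀ i, (fun x => f' x i) ∈ regularOn g)
    (hg : ∀ x, aeval (f x) g = aeval x g) (hg' : ∀ x, aeval (f' x) g = aeval x g)
    (hl : Function.LeftInverse f' f) (hr : Function.RightInverse f' f)
    (P : {P : PrimeSpectrum (MvPolynomial σ F) // g ∉ P.asIdeal}) :
    primeImage hf' hg' (primeImage hf hg P) = P := by
  apply Subtype.ext
  apply PrimeSpectrum.ext
  simp only [primeImage]
  rw [← closure_eq_zeroLocus, image_inter_eq hg hl hr,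
    closure_inter_subset_of_continuousOn (continuousOn_of_mem_regularOn hf') (isClosed_zeroLocus _),
    ← image_inter_eq hg hl hr, ← Set.image_comp, hl.comp_eq_id, Set.image_id,
    vanishingIdeal_zeroLocus_inter _ P.2]

/-- The codimension is invariant under automorphisms of the principal open set `g ≠ 0`. -/
theorem codim_closure_image [IsAlgClosed F] [Finite σ] {g : MvPolynomial σ F}
    {f f' : (σ → F) → (σ → F)} (hf : ∀ i, (fun x => f x i) ∈ regularOn g)
    (hf' : ∀ i, (fun x => f' x i) ∈ regularOn g)
    (hg : ∀ x, aeval (f x) g = aeval x g) (hg' : ∀ x, aeval (f' x) g = aeval x g)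
    (hl : Function.LeftInverse f' f) (hr : Function.RightInverse f' f)
    {W : Set (σ → F)} (hW : IsIrreducible W) (hWc : IsClosed W)
    (hWg : (W ∩ {x | aeval x g ≠ 0}).Nonempty) :
    codim (closure (f '' (W ∩ {x | aeval x g ≠ 0}))) = codim W := by
  let e : {P : PrimeSpectrum (MvPolynomial σ F) // g ∉ P.asIdeal} ≃o
      {P : PrimeSpectrum (MvPolynomial σ F) // g ∉ P.asIdeal} :=
    Equiv.toOrderIso ⟨primeImage hf hg, primeImage hf' hg',
      primeImage_primeImage hf hf' hg hg' hl hr, primeImage_primeImage hf' hf hg' hg hr hl⟩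
      (fun P Q h => vanishingIdeal_anti_mono (Set.image_mono
        (Set.inter_subset_inter_left _ (zeroLocus_anti_mono h))))
      (fun P Q h => vanishingIdeal_anti_mono (Set.image_mono
        (Set.inter_subset_inter_left _ (zeroLocus_anti_mono h))))
  -- A prime contained in one that avoids `g` also avoids `g`, so heights may be computed among the
  -- primes avoiding `g`, where the order isomorphism `e` acts.
  have hval : ∀ P : {P : PrimeSpectrum (MvPolynomial σ F) // g ∉ P.asIdeal},
      Order.height P = P.1.asIdeal.height := fun P => by
    rw [PrimeSpectrum.height_eq_orderHeight]
    exact Order.height_eq_of_strictMono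
      (fun Q : {P : PrimeSpectrum (MvPolynomial σ F) // g ∉ P.asIdeal} => Q.1) (fun _ _ h => h)
      (fun a b hb => ⟨⟨b, fun h => a.2 ((show b ≤ a.1 from hb.le) h)⟩, hb, rfl⟩) P
  have hgW : g ∉ vanishingIdeal F W := by
    obtain ⟨x, hx, hxg⟩ := hWg
    exact fun h => hxg (h x hx)
  have key := Order.height_orderIso e
    ⟨⟨_, isIrreducible_iff_isPrime_vanishingIdeal.1 hW⟩, hgW⟩
  rw [hval, hval] at key
  rw [codim, codim, vanishingIdeal_closure, ← key]
  simp only [e, primeImage, Equiv.toOrderIso, RelIso.coe_fn_mk, Equiv.coe_fn_mk]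
  rw [← closure_eq_zeroLocus, hWc.closure_eq]

end Codim

/-! ### Vanishing of minors under row operations and Schur complements -/

section Minors

open Matrix

variable {R : Type*} [CommRing R] {m n r : ℕ}

/-- All `r × r` minors of `M` are zero. -/
def MinorsVanish {m n : ℕ} (r : ℕ) (M : Matrix (Fin m) (Fin n) R) : Prop :=
  ∀ (a : Fin r → Fin m) (b : Fin r → Fin n), (M.submatrix a b).det = 0

/-- A repeated index makes the determinant zero, and sorting injective indices changes it by a sign
only. Arbitrary index functions are convenient because row operations substitute indices without
regard to order or repetition. -/
theorem minorsVanish_iff_orderEmbedding {M : Matrix (Fin m) (Fin n) R} :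
    MinorsVanish r M ↔ ∀ (a : Fin r ↪o Fin m) (b : Fin r ↪o Fin n), (M.submatrix a b).det = 0 := by
  refine ⟨fun h a b => h a b, fun h a b => ?_⟩
  by_cases ha : a.Injective
  · by_cases hb : b.Injective
    · have hsa : StrictMono (a ∘ Tuple.sort a) :=
        (Tuple.monotone_sort a).strictMono_of_injective (ha.comp (Equiv.injective _))
      have hsb : StrictMono (b ∘ Tuple.sort b) :=
        (Tuple.monotone_sort b).strictMono_of_injective (hb.comp (Equiv.injective _))
      have h1 := h (OrderEmbedding.ofStrictMono _ hsa) (OrderEmbedding.ofStrictMono _ hsb)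
      have h2 : M.submatrix (OrderEmbedding.ofStrictMono _ hsa) (OrderEmbedding.ofStrictMono _ hsb)
          = ((M.submatrix a b).submatrix (Tuple.sort a) id).submatrix id (Tuple.sort b) := rfl
      rw [h2, det_permute', det_permute] at h1
      rcases Int.units_eq_one_or (Equiv.Perm.sign (Tuple.sort a)) with h3 | h3 <;>
      rcases Int.units_eq_one_or (Equiv.Perm.sign (Tuple.sort b)) with h4 | h4 <;>
      simpa [h3, h4] using h1
    · simp only [Function.Injective, not_forall] at hb
      obtain ⟨i, j, hij, hne⟩ := hb
      exact det_zero_of_column_eq hne fun k => by simp [hij]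
  · simp only [Function.Injective, not_forall] at ha
    obtain ⟨i, j, hij, hne⟩ := ha
    exact det_zero_of_row_eq hne (by ext k; simp [hij])

theorem MinorsVanish.transpose {M : Matrix (Fin m) (Fin n) R} (h : MinorsVanish r M) :
    MinorsVanish r Mᵀ := fun a b => by
  rw [← transpose_submatrix, det_transpose]
  exact h b a

/-- Adding multiples of one row to the rows of a matrix preserves the vanishing of minors. -/
theorem MinorsVanish.add_row {M : Matrix (Fin m) (Fin n) R} (h : MinorsVanish r M)
    (c : Fin m → R) (p : Fin m) :
    MinorsVanish r (of fun i j => M i j + c i * M p j) := by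
  intro a b
  have key : ((of fun i j => M i j + c i * M p j).submatrix a b) =
      (of fun i => M.submatrix a b i + fun j => c (a i) * M p (b j)) := by
    ext; simp
  -- The determinant is expanded multilinearly over the sets `s` of rows where the original summand
  -- is kept. Each term is a multiple of the minor whose row indices outside `s` are replaced by
  -- `p`.
  have hm := (detRowAlternating (R := R) (n := Fin r)).toMultilinearMap.map_add_univ
    (fun i => M.submatrix a b i) (fun i j => c (a i) * M p (b j))
  rw [key]
  refine hm.trans (Finset.sum_eq_zero fun s _ => ?_)
  have : (s.piecewise (fun i => M.submatrix a b i) fun i j => c (a i) * M p (b j)) =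
      fun i => (if i ∈ s then 1 else c (a i)) •
        (M.submatrix (fun i => if i ∈ s then a i else p) b) i := by
    ext i j
    by_cases hi : i ∈ s <;> simp [hi]
  rw [this]
  exact (MultilinearMap.map_smul_univ _ _ _).trans (smul_eq_zero_of_right _ (h _ _))

theorem MinorsVanish.add_column {M : Matrix (Fin m) (Fin n) R} (h : MinorsVanish r M)
    (c : Fin n → R) (q : Fin n) :
    MinorsVanish r (of fun i j => M i j + c j * M i q) :=
  (h.transpose.add_row c q).transpose

/-- An injective choice of `r + 1` rows meets `p` at most once. Laplace expansion along that row
leaves minors of size `r` that avoid `p`. -/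
theorem minorsVanish_succ_of_forall_ne {M : Matrix (Fin m) (Fin n) R} (p : Fin m)
    (h : ∀ (a : Fin r → Fin m) (b : Fin r → Fin n), (∀ i, a i ≠ p) → (M.submatrix a b).det = 0) :
    MinorsVanish (r + 1) M := by
  intro a b
  by_cases ha : a.Injective
  · obtain ⟨i, hi⟩ : ∃ i, ∀ j, j ≠ i → a j ≠ p := by
      by_cases hp : ∃ i, a i = p
      · obtain ⟨i, rfl⟩ := hp
        exact ⟨i, fun j hj => ha.ne hj⟩
      · exact ⟨0, fun j _ hj => hp ⟨j, hj⟩⟩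
    rw [det_succ_row _ i]
    refine Finset.sum_eq_zero fun j _ => ?_
    rw [submatrix_submatrix, h (a ∘ i.succAbove) _ fun l => hi _ (Fin.succAbove_ne i l), mul_zero]
  · simp only [Function.Injective, not_forall] at ha
    obtain ⟨i, j, hij, hne⟩ := ha
    exact det_zero_of_row_eq hne (by ext k; simp [hij])

/-- A minor of size `r` avoiding row `p` is a multiple of `t ^ r`. With `t ^ k = 0` this is how the
bound `k ≤ r` enters. -/
theorem minorsVanish_succ_of_dvd {M : Matrix (Fin m) (Fin n) R} (p : Fin m) {t : R}
    (ht : t ^ r = 0) (h : ∀ i, i ≠ p → ∀ j, t ∣ M i j) : MinorsVanish (r + 1) M := by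
  refine minorsVanish_succ_of_forall_ne p fun a b ha => ?_
  choose N hN using fun (i : Fin r) (j : Fin r) => h (a i) (ha i) (b j)
  have : M.submatrix a b = t • of N := by
    ext i j
    simp [hN]
  rw [this, det_smul, Fintype.card_fin, ht, zero_mul]

/-- Bordering a small minor by the last row and column multiplies it by the unit corner. Conversely,
a minor avoiding the last row either has a zero column or is a minor of the smaller matrix. -/
theorem minorsVanish_succ_iff_of_column_eq_zero {D : Matrix (Fin (m + 1)) (Fin (n + 1)) R}
    (hu : IsUnit (D (Fin.last m) (Fin.last n))) (h0 : ∀ i : Fin m, D i.castSucc (Fin.last n) = 0) :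
    MinorsVanish (r + 1) D ↔ MinorsVanish r (D.submatrix Fin.castSucc Fin.castSucc) := by
  constructor
  · intro h a b
    have h1 := h (Fin.cons (Fin.last m) (Fin.castSucc ∘ a)) (Fin.cons (Fin.last n) (Fin.castSucc ∘ b))
    rw [det_succ_column_zero, Finset.sum_eq_single 0] at h1
    · have h2 : (D.submatrix (Fin.cons (Fin.last m) (Fin.castSucc ∘ a) : Fin (r + 1) → _)
          (Fin.cons (Fin.last n) (Fin.castSucc ∘ b) : Fin (r + 1) → _)).submatrix
            (Fin.succAbove 0) Fin.succ =
          (D.submatrix Fin.castSucc Fin.castSucc).submatrix a b := by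
        ext i j; simp
      rw [h2] at h1
      simpa [hu.mul_right_eq_zero] using h1
    · intro i _ hi
      obtain ⟨i, rfl⟩ := Fin.exists_succ_eq.2 hi
      simp [h0]
    · simp
  · intro h
    refine minorsVanish_succ_of_forall_ne (Fin.last m) fun a b ha => ?_
    choose a' ha' using fun i => Fin.exists_castSucc_eq.2 (ha i)
    by_cases hb : ∃ j, b j = Fin.last n
    · obtain ⟨j, hj⟩ := hb
      exact det_eq_zero_of_column_eq_zero j fun i => by simp [hj, ← ha', h0]
    · simp only [not_exists] at hb
      choose b' hb' using fun i => Fin.exists_castSucc_eq.2 (hb i)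
      rw [← h a' b', submatrix_submatrix, show a = Fin.castSucc ∘ a' from (_root_.funext ha').symm,
        show b = Fin.castSucc ∘ b' from (_root_.funext hb').symm]

theorem minorsVanish_succ_iff_schur {M : Matrix (Fin (m + 1)) (Fin (n + 1)) R} {v : R}
    (hv : M (Fin.last m) (Fin.last n) * v = 1) :
    MinorsVanish (r + 1) M ↔ MinorsVanish r (of fun (i : Fin m) (j : Fin n) =>
      M i.castSucc j.castSucc - M (Fin.last m) j.castSucc * M i.castSucc (Fin.last n) * v) := by
  -- These multiples of the last row clear the last column. Since `c` is zero at the last row, that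
  -- row is unchanged and `-c` undoes the operation.
  set c : Fin (m + 1) → R := fun i => if i = Fin.last m then 0 else -(M i (Fin.last n) * v) with hc
  set D : Matrix (Fin (m + 1)) (Fin (n + 1)) R := of fun i j => M i j + c i * M (Fin.last m) j
    with hD
  have hDl : ∀ j, D (Fin.last m) j = M (Fin.last m) j := fun j => by simp [hD, hc]
  have hM : M = of fun i j => D i j + (-c i) * D (Fin.last m) j := by
    ext i j
    rw [of_apply, hDl]
    simp [hD]
  have h1 : MinorsVanish (r + 1) M ↔ MinorsVanish (r + 1) D := by
    refine ⟨fun h => h.add_row c _, fun h => ?_⟩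
    rw [hM]
    exact h.add_row (fun i => -c i) _
  rw [h1, minorsVanish_succ_iff_of_column_eq_zero]
  · have : D.submatrix Fin.castSucc Fin.castSucc = (of fun (i : Fin m) (j : Fin n) =>
      M i.castSucc j.castSucc - M (Fin.last m) j.castSucc * M i.castSucc (Fin.last n) * v) := by
      ext i j
      simp only [hD, hc, submatrix_apply, of_apply, (Fin.castSucc_lt_last i).ne, if_false]
      ring
    rw [this]
  · rw [hDl]
    exact IsUnit.of_mul_eq_one v hv
  · intro i
    simp only [hD, hc, of_apply, (Fin.castSucc_lt_last i).ne, if_false]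
    linear_combination (-M i.castSucc (Fin.last n)) * hv

end Minors

/-! ### Points of the variety as matrices over `F[t]/(t^k)` -/

section DetVariety

variable {F : Type*} [Field F] {m n r k : ℕ}

/-- The ring `F[t]/(t^k)`. -/
abbrev TruncRing (F : Type*) [Field F] (k : ℕ) : Type _ :=
  PowerSeries F ⧸ Ideal.span {(PowerSeries.X : PowerSeries F) ^ k}

theorem truncRing_mk_eq_iff {f g : PowerSeries F} :
    (Ideal.Quotient.mk _ f : TruncRing F k) = Ideal.Quotient.mk _ g ↔
      ∀ l < k, PowerSeries.coeff l f = PowerSeries.coeff l g := by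
  rw [Ideal.Quotient.eq, Ideal.mem_span_singleton, PowerSeries.X_pow_dvd_iff]
  simp [sub_eq_zero]

/-- The matrix over `F[t]/(t^k)` with coordinates `x`. -/
noncomputable def truncMatrix (x : Aff F m n k) : Matrix (Fin m) (Fin n) (TruncRing F k) :=
  Matrix.of fun i j => Ideal.Quotient.mk _ (entry x i j)

theorem coeff_entry (x : Aff F m n k) (i : Fin m) (j : Fin n) (l : Fin k) :
    PowerSeries.coeff (l : ℕ) (entry x i j) = x (i, j, l) := by
  simp [entry]

theorem truncMatrix_eq_mk {x : Aff F m n k} {i : Fin m} {j : Fin n} {f : PowerSeries F}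
    (h : ∀ l : Fin k, x (i, j, l) = PowerSeries.coeff (l : ℕ) f) :
    truncMatrix x i j = Ideal.Quotient.mk _ f :=
  truncRing_mk_eq_iff.2 fun l hl => by rw [← h ⟨l, hl⟩, ← coeff_entry x]

/-- Evaluation of the coefficients at `x`, as a map `S[t] → F⟦t⟧`. -/
noncomputable def evalSeries (x : Aff F m n k) :
    Polynomial (MvPolynomial (Idx m n k) F) →+* PowerSeries F :=
  Polynomial.coeToPowerSeries.ringHom.comp (Polynomial.mapRingHom (aeval x).toRingHom)

theorem coeff_evalSeries (x : Aff F m n k) (p : Polynomial (MvPolynomial (Idx m n k) F)) (l : ℕ) :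
    PowerSeries.coeff l (evalSeries x p) = aeval x (p.coeff l) := by
  simp [evalSeries]

theorem evalSeries_genericMatrix (x : Aff F m n k) (i : Fin m) (j : Fin n) :
    evalSeries x (genericMatrix F m n k i j) = entry x i j := by
  ext l
  rw [coeff_evalSeries, genericMatrix, Matrix.of_apply, Polynomial.finsetSum_coeff, entry,
    PowerSeries.coeff_mk, map_sum]
  simp only [Polynomial.coeff_C_mul, Polynomial.coeff_X_pow, mul_ite, mul_one, mul_zero]
  split_ifs with h
  · rw [Finset.sum_eq_single ⟨l, h⟩]
    · simp
    · intro b _ hb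
      rw [if_neg fun h => hb (Fin.ext h.symm), map_zero]
    · simp
  · refine Finset.sum_eq_zero fun b _ => ?_
    rw [if_neg fun h' : l = b => h (h'.trans_lt b.2), map_zero]

/-- Evaluation at `x` and reduction modulo `t^k` are ring homomorphisms, so they commute with
determinants. An element of the quotient is zero exactly when its coefficients below `k` are. -/
theorem mem_detVariety_iff {x : Aff F m n k} :
    x ∈ detVariety F m n r k ↔ MinorsVanish r (truncMatrix x) := by
  rw [minorsVanish_iff_orderEmbedding, detVariety, detIdeal, zeroLocus_span]
  have key : ∀ (a : Fin r ↪o Fin m) (b : Fin r ↪o Fin n),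
      ((truncMatrix x).submatrix a b).det =
        Ideal.Quotient.mk _ (evalSeries x ((genericMatrix F m n k).submatrix a b).det) := by
    intro a b
    rw [RingHom.map_det, RingHom.map_det]
    congr 1
    ext i j
    simp [truncMatrix, evalSeries_genericMatrix]
  simp only [key]
  constructor
  · intro h a b
    rw [← map_zero (Ideal.Quotient.mk _), truncRing_mk_eq_iff]
    intro l hl
    rw [coeff_evalSeries, map_zero]
    exact h _ ⟨a, b, ⟨l, hl⟩, rfl⟩
  · rintro h _ ⟨a, b, l, rfl⟩
    have := h a b
    rw [← map_zero (Ideal.Quotient.mk _), truncRing_mk_eq_iff] at this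
    rw [← coeff_evalSeries, this l l.2, map_zero]

theorem truncMatrix_schur (x : Aff F (m + 1) (n + 1) k) (i : Fin m) (j : Fin n) :
    truncMatrix (schur x) i j = truncMatrix x i.castSucc j.castSucc -
      truncMatrix x (Fin.last m) j.castSucc * truncMatrix x i.castSucc (Fin.last n) *
        Ideal.Quotient.mk _ (entry x (Fin.last m) (Fin.last n))⁻¹ :=
  truncMatrix_eq_mk fun _ => rfl

theorem schur_mem_detVariety_iff {x : Aff F (m + 1) (n + 1) k}
    (hx : PowerSeries.constantCoeff (entry x (Fin.last m) (Fin.last n)) ≠ 0) :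
    schur x ∈ detVariety F m n r k ↔ x ∈ detVariety F (m + 1) (n + 1) (r + 1) k := by
  rw [mem_detVariety_iff, mem_detVariety_iff, minorsVanish_succ_iff_schur
    (v := Ideal.Quotient.mk _ (entry x (Fin.last m) (Fin.last n))⁻¹)]
  · have : truncMatrix (schur x) = Matrix.of fun (i : Fin m) (j : Fin n) =>
      truncMatrix x i.castSucc j.castSucc -
      truncMatrix x (Fin.last m) j.castSucc * truncMatrix x i.castSucc (Fin.last n) *
        Ideal.Quotient.mk _ (entry x (Fin.last m) (Fin.last n))⁻¹ :=
      Matrix.ext (truncMatrix_schur x)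
    rw [this]
  · rw [truncMatrix, Matrix.of_apply, ← map_mul, PowerSeries.mul_inv_cancel _ hx, map_one]

end DetVariety

/-! ### The automorphism that straightens `schur` into a projection -/

section Shear

variable {F : Type*} [Field F] {m n k : ℕ}

/-- The corner coordinate `x_{last,last}^{(0)}`. -/
noncomputable def corner (F : Type*) [Field F] (m n : ℕ) {k : ℕ} (hk : 1 ≤ k) :
    MvPolynomial (Idx (m + 1) (n + 1) k) F :=
  X (Fin.last m, Fin.last n, ⟨0, hk⟩)

theorem aeval_corner (hk : 1 ≤ k) (x : Aff F (m + 1) (n + 1) k) :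
    aeval x (corner F m n hk) = x (Fin.last m, Fin.last n, ⟨0, hk⟩) := by
  rw [corner, aeval_X]

theorem constantCoeff_entry (hk : 1 ≤ k) (x : Aff F (m + 1) (n + 1) k) :
    PowerSeries.constantCoeff (entry x (Fin.last m) (Fin.last n)) = aeval x (corner F m n hk) := by
  rw [aeval_corner, ← coeff_entry x, PowerSeries.coeff_zero_eq_constantCoeff_apply]

/-- The product `x_{last,j} x_{i,last} x_{last,last}⁻¹`. -/
noncomputable def pivotProduct (x : Aff F (m + 1) (n + 1) k) (i : Fin (m + 1)) (j : Fin (n + 1)) :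
    PowerSeries F :=
  entry x (Fin.last m) j * entry x i (Fin.last n) * (entry x (Fin.last m) (Fin.last n))⁻¹

/-- The matrix with entries `x_{i,j} + ε x_{last,j} x_{i,last} x_{last,last}⁻¹` outside of the last
row and column, which are unchanged. -/
noncomputable def shear (ε : F) (x : Aff F (m + 1) (n + 1) k) : Aff F (m + 1) (n + 1) k :=
  fun q => if q.1 = Fin.last m ∨ q.2.1 = Fin.last n then x q
    else x q + ε * PowerSeries.coeff (q.2.2 : ℕ) (pivotProduct x q.1 q.2.1)

theorem shear_apply_of_eq_last (ε : F) (x : Aff F (m + 1) (n + 1) k) {q : Idx (m + 1) (n + 1) k}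
    (h : q.1 = Fin.last m ∨ q.2.1 = Fin.last n) : shear ε x q = x q := if_pos h

theorem entry_shear_of_eq_last (ε : F) (x : Aff F (m + 1) (n + 1) k) {i : Fin (m + 1)}
    {j : Fin (n + 1)} (h : i = Fin.last m ∨ j = Fin.last n) :
    entry (shear ε x) i j = entry x i j := by
  simp only [entry, shear_apply_of_eq_last (q := (i, j, _)) ε x h]

theorem pivotProduct_shear (ε : F) (x : Aff F (m + 1) (n + 1) k) (i : Fin (m + 1))
    (j : Fin (n + 1)) : pivotProduct (shear ε x) i j = pivotProduct x i j := by
  simp only [pivotProduct, entry_shear_of_eq_last, true_or, or_true]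

/-- The added term depends only on the last row and column, which `shear` fixes. The identity thus
holds on the whole space, whatever value the inverse takes where the corner is not invertible. -/
theorem shear_shear (ε δ : F) (x : Aff F (m + 1) (n + 1) k) :
    shear δ (shear ε x) = shear (ε + δ) x := by
  ext q
  by_cases h : q.1 = Fin.last m ∨ q.2.1 = Fin.last n
  · simp only [shear_apply_of_eq_last _ _ h]
  · simp only [shear, if_neg h, pivotProduct_shear]
    ring

theorem shear_zero (x : Aff F (m + 1) (n + 1) k) : shear 0 x = x := by
  ext q
  simp [shear]

theorem leftInverse_shear {ε δ : F} (h : ε + δ = 0) :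
    Function.LeftInverse (shear δ : Aff F (m + 1) (n + 1) k → _) (shear ε) := fun x => by
  rw [shear_shear, h, shear_zero]

theorem aeval_shear_corner (hk : 1 ≤ k) (ε : F) (x : Aff F (m + 1) (n + 1) k) :
    aeval (shear ε x) (corner F m n hk) = aeval x (corner F m n hk) := by
  rw [aeval_corner, aeval_corner, shear_apply_of_eq_last _ _ (Or.inl rfl)]

theorem coeff_mul_mem_regularOn {σ : Type*} {g : MvPolynomial σ F} {a b : (σ → F) → PowerSeries F}
    (ha : ∀ l, (fun x => PowerSeries.coeff l (a x)) ∈ regularOn g)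
    (hb : ∀ l, (fun x => PowerSeries.coeff l (b x)) ∈ regularOn g) (l : ℕ) :
    (fun x => PowerSeries.coeff l (a x * b x)) ∈ regularOn g := by
  have : (fun x => PowerSeries.coeff l (a x * b x)) =
      ∑ q ∈ Finset.HasAntidiagonal.antidiagonal l,
        (fun x => PowerSeries.coeff q.1 (a x)) * (fun x => PowerSeries.coeff q.2 (b x)) := by
    ext x
    simp [PowerSeries.coeff_mul]
  rw [this]
  exact sum_mem fun q _ => mul_mem (ha _) (hb _)

/-- The recursion for the coefficients of an inverse series divides by the constant coefficient
only. -/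
theorem coeff_inv_mem_regularOn {σ : Type*} {g : MvPolynomial σ F} {a : (σ → F) → PowerSeries F}
    (ha : ∀ l, (fun x => PowerSeries.coeff l (a x)) ∈ regularOn g)
    (hg : ∀ x, PowerSeries.constantCoeff (a x) = aeval x g) (l : ℕ) :
    (fun x => PowerSeries.coeff l (a x)⁻¹) ∈ regularOn g := by
  induction l using Nat.strong_induction_on with
  | _ l ih =>
    by_cases hl : l = 0
    · have : (fun x => PowerSeries.coeff l (a x)⁻¹) = fun x => (aeval x g)⁻¹ := by
        ext x
        rw [PowerSeries.coeff_inv, if_pos hl, hg]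
      rw [this]
      exact inv_mem_regularOn g
    · have : (fun x => PowerSeries.coeff l (a x)⁻¹) =
          -(fun x => (aeval x g)⁻¹) * ∑ q ∈ Finset.HasAntidiagonal.antidiagonal l,
            if q.2 < l then (fun x => PowerSeries.coeff q.1 (a x)) *
              (fun x => PowerSeries.coeff q.2 (a x)⁻¹) else 0 := by
        ext x
        rw [PowerSeries.coeff_inv, if_neg hl, hg]
        simp only [Pi.mul_apply, Pi.neg_apply, Finset.sum_apply]
        congr 1
        refine Finset.sum_congr rfl fun q _ => ?_
        split_ifs <;> rfl
      rw [this]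
      refine mul_mem (neg_mem (inv_mem_regularOn g)) (sum_mem fun q _ => ?_)
      split_ifs with hq
      · exact mul_mem (ha _) (ih _ hq)
      · exact zero_mem _

theorem coeff_entry_mem_regularOn (g : MvPolynomial (Idx m n k) F) (i : Fin m) (j : Fin n)
    (l : ℕ) : (fun x => PowerSeries.coeff l (entry x i j)) ∈ regularOn g := by
  simp only [entry, PowerSeries.coeff_mk]
  split_ifs with h
  · exact coord_mem_regularOn g _
  · exact const_mem_regularOn g 0

theorem shear_mem_regularOn (hk : 1 ≤ k) (ε : F) (q : Idx (m + 1) (n + 1) k) :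
    (fun x => shear ε x q) ∈ regularOn (corner F m n hk) := by
  by_cases h : q.1 = Fin.last m ∨ q.2.1 = Fin.last n
  · simpa only [shear_apply_of_eq_last _ _ h] using coord_mem_regularOn _ q
  · simp only [shear, if_neg h]
    refine add_mem (coord_mem_regularOn _ q) (mul_mem (const_mem_regularOn _ ε) ?_)
    exact coeff_mul_mem_regularOn (coeff_mul_mem_regularOn (coeff_entry_mem_regularOn _ _ _)
      (coeff_entry_mem_regularOn _ _ _)) (coeff_inv_mem_regularOn
        (coeff_entry_mem_regularOn _ _ _) (constantCoeff_entry hk)) _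

/-- The inclusion of the index set of the matrix without its last row and column. -/
def castIdx (q : Idx m n k) : Idx (m + 1) (n + 1) k := (q.1.castSucc, q.2.1.castSucc, q.2.2)

theorem castIdx_injective : Function.Injective (castIdx : Idx m n k → _) := by
  rintro ⟨a, b, c⟩ ⟨a', b', c'⟩ h
  simpa [castIdx] using h

theorem schur_eq_shear_comp (x : Aff F (m + 1) (n + 1) k) : schur x = shear (-1) x ∘ castIdx := by
  ext q
  have h : ¬(q.1.castSucc = Fin.last m ∨ q.2.1.castSucc = Fin.last n) := by
    simp [(Fin.castSucc_lt_last _).ne]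
  rw [Function.comp, shear, castIdx, if_neg h, schur, map_sub, coeff_entry, pivotProduct]
  ring

end Shear

/-! ### Density of the locus where the corner is invertible -/

section Density

variable {F : Type*} [Field F] {m n r k : ℕ}

/-- Adding a scalar `s` to the corner leaves all the other rows divisible by `t`, so the minors of
size `r + 1` are still zero; for `s ≠ 0` the corner becomes invertible. -/
theorem mem_closure_of_degree_zero_eq_zero [Infinite F] (hk : 1 ≤ k) (hkr : k ≤ r)
    {x : Aff F (m + 1) (n + 1) k}
    (hx : ∀ (i : Fin (m + 1)) (j : Fin (n + 1)) (l : Fin k), (l : ℕ) = 0 → x (i, j, l) = 0) :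
    x ∈ closure (detVariety F (m + 1) (n + 1) (r + 1) k ∩
      {x | aeval x (corner F m n hk) ≠ 0}) := by
  let q₀ : Idx (m + 1) (n + 1) k := (Fin.last m, Fin.last n, ⟨0, hk⟩)
  let c : Idx (m + 1) (n + 1) k → Polynomial F := fun q =>
    Polynomial.C (x q) + if q = q₀ then Polynomial.X else 0
  have hc0 : (fun q => (c q).eval 0) = x := by
    ext q
    by_cases h : q = q₀ <;> simp [c, h]
  have hc : ∀ s q, q ≠ q₀ → (c q).eval s = x q := fun s q hq => by simp [c, hq]
  suffices key : (fun q => (c q).eval 0) ∈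
      closure (detVariety F (m + 1) (n + 1) (r + 1) k ∩ {x | aeval x (corner F m n hk) ≠ 0}) by
    rwa [hc0] at key
  refine mem_closure_of_curve c Polynomial.X_ne_zero (fun s hs => ?_) 0
  refine ⟨?_, ?_⟩
  · rw [mem_detVariety_iff]
    refine minorsVanish_succ_of_dvd (Fin.last m) (t := Ideal.Quotient.mk _ PowerSeries.X) ?_ ?_
    · rw [← map_pow, Ideal.Quotient.eq_zero_iff_mem, Ideal.mem_span_singleton]
      exact pow_dvd_pow _ hkr
    · intro i hi j
      refine (Ideal.Quotient.mk _).map_dvd ?_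
      rw [PowerSeries.X_dvd_iff, ← PowerSeries.coeff_zero_eq_constantCoeff_apply, entry,
        PowerSeries.coeff_mk, dif_pos (Nat.pos_of_ne_zero (Nat.one_le_iff_ne_zero.1 hk)), hc _ _ fun h => hi (congrArg Prod.fst h), hx _ _ _ rfl]
  · rw [Set.mem_ofPred_eq, aeval_corner]
    simpa [c, q₀, hx] using hs

/-- The curve adds `s` times row `i₀` to the last row, then `s` times column `j₀` to the last
column. This preserves the vanishing of minors. -/
theorem mem_closure_of_degree_zero_ne_zero [Infinite F] (hk : 1 ≤ k)
    {x : Aff F (m + 1) (n + 1) k} (hxZ : x ∈ detVariety F (m + 1) (n + 1) r k)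
    {i₀ : Fin (m + 1)} {j₀ : Fin (n + 1)} (hx : x (i₀, j₀, ⟨0, hk⟩) ≠ 0) :
    x ∈ closure (detVariety F (m + 1) (n + 1) r k ∩
      {x | aeval x (corner F m n hk) ≠ 0}) := by
  let d : Fin (m + 1) → F := fun i => if i = Fin.last m then 1 else 0
  let d' : Fin (n + 1) → F := fun j => if j = Fin.last n then 1 else 0
  let c : Idx (m + 1) (n + 1) k → Polynomial F := fun q =>
    Polynomial.C (x q) + Polynomial.C (d q.1 * x (i₀, q.2)) * Polynomial.X +
      Polynomial.C (d' q.2.1) * Polynomial.X * (Polynomial.C (x (q.1, j₀, q.2.2)) +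
        Polynomial.C (d q.1 * x (i₀, j₀, q.2.2)) * Polynomial.X)
  have hc0 : (fun q => (c q).eval 0) = x := by
    ext q
    simp [c]
  suffices key : (fun q => (c q).eval 0) ∈
      closure (detVariety F (m + 1) (n + 1) r k ∩ {x | aeval x (corner F m n hk) ≠ 0}) by
    rwa [hc0] at key
  refine mem_closure_of_curve c (h := c (Fin.last m, Fin.last n, ⟨0, hk⟩)) ?_
    (fun s hs => ?_) 0
  · intro h
    apply hx
    -- The corner coordinate along the curve is quadratic in `s`, with `x (i₀, j₀, 0)` as
    -- coefficient of `s ^ 2`.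
    have := congrArg (fun p => Polynomial.coeff p 2) h
    simpa [c, d, d', mul_add, Polynomial.coeff_X, Polynomial.coeff_C, ← mul_assoc,
      mul_right_comm _ _ (Polynomial.X : Polynomial F)] using this
  · refine ⟨?_, by rwa [Set.mem_ofPred_eq, aeval_corner]⟩
    rw [mem_detVariety_iff] at hxZ ⊢
    have h := (hxZ.add_row (fun i => Ideal.Quotient.mk _ (PowerSeries.C (s * d i))) i₀).add_column
      (fun j => Ideal.Quotient.mk _ (PowerSeries.C (s * d' j))) j₀
    convert h using 1
    ext i j
    simp only [Matrix.of_apply]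
    refine (truncMatrix_eq_mk (f := entry x i j + PowerSeries.C (s * d i) * entry x i₀ j +
      PowerSeries.C (s * d' j) * (entry x i j₀ + PowerSeries.C (s * d i) * entry x i₀ j₀))
      fun l => ?_).trans ?_
    · simp only [map_add, PowerSeries.coeff_C_mul, coeff_entry]
      simp only [c, Polynomial.eval_add, Polynomial.eval_mul, Polynomial.eval_C, Polynomial.eval_X]
      ring
    · simp [truncMatrix]

theorem detVariety_subset_closure [Infinite F] (hk : 1 ≤ k) (hkr : k ≤ r) :
    detVariety F (m + 1) (n + 1) (r + 1) k ⊆ closure (detVariety F (m + 1) (n + 1) (r + 1) k ∩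
      {x | aeval x (corner F m n hk) ≠ 0}) := by
  intro x hx
  by_cases h : ∃ i j, x (i, j, ⟨0, hk⟩) ≠ 0
  · obtain ⟨i, j, h⟩ := h
    exact mem_closure_of_degree_zero_ne_zero hk hx h
  · push Not at h
    refine mem_closure_of_degree_zero_eq_zero hk hkr fun i j l hl => ?_
    rw [← h i j]
    congr 3
    exact Fin.ext hl

/-- A point with nonzero corner lies on a minimal prime that cannot contain the corner variable.
Density extends this to all points, since `Z_0` is a finite union of closed sets. -/
theorem detVariety_subset_detVarietyZero [Infinite F] (hk : 1 ≤ k) (hkr : k ≤ r) :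
    detVariety F (m + 1) (n + 1) (r + 1) k ⊆ detVarietyZero F (m + 1) (n + 1) (r + 1) k := by
  refine (detVariety_subset_closure hk hkr).trans (closure_minimal ?_ ?_)
  · rintro x ⟨hx, hxc⟩
    have hle : detIdeal F (m + 1) (n + 1) (r + 1) k ≤ vanishingIdeal F {x} :=
      le_zeroLocus_iff_le_vanishingIdeal.1 (Set.singleton_subset_iff.2 hx)
    obtain ⟨P, hP, hPx⟩ := Ideal.exists_minimalPrimes_le hle
    refine Set.mem_biUnion (x := P) ⟨hP, Fin.last m, Fin.last n, ⟨0, hk⟩, rfl, fun h => hxc ?_⟩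
      fun p hp => hPx hp x rfl
    exact hPx h x rfl
  · refine Set.Finite.isClosed_biUnion ?_ fun P _ => isClosed_zeroLocus P
    exact (Ideal.finite_minimalPrimes_of_isNoetherianRing _ _).subset fun P hP => hP.1

end Density

/-! ### The correspondence of irreducible components -/

section Lift

variable {F : Type*} [Field F] {m n r k : ℕ}

theorem setOf_schur_mem_eq (hk : 1 ≤ k) (C : Set (Aff F m n k)) :
    {x : Aff F (m + 1) (n + 1) k |
      PowerSeries.constantCoeff (entry x (Fin.last m) (Fin.last n)) ≠ 0 ∧ schur x ∈ C} =
      schur ⁻¹' C ∩ {x | aeval x (corner F m n hk) ≠ 0} := by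
  ext x
  simp only [constantCoeff_entry hk]
  exact and_comm

theorem lift_eq (hk : 1 ≤ k) (C : Set (Aff F m n k)) :
    lift C = closure (schur ⁻¹' C ∩ {x | aeval x (corner F m n hk) ≠ 0}) := by
  rw [lift, setOf_schur_mem_eq hk]

theorem preimage_schur_inter_eq (hk : 1 ≤ k) (C : Set (Aff F m n k)) :
    schur ⁻¹' C ∩ {x | aeval x (corner F m n hk) ≠ 0} =
      shear 1 '' ((fun x => x ∘ castIdx) ⁻¹' C ∩ {x | aeval x (corner F m n hk) ≠ 0}) := by
  rw [image_inter_eq (aeval_shear_corner hk 1) (leftInverse_shear (add_neg_cancel 1))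
    (leftInverse_shear (neg_add_cancel 1))]
  ext x
  simp only [Set.mem_inter_iff, Set.mem_preimage, schur_eq_shear_comp]

theorem exists_comp_castIdx_eq (hk : 1 ≤ k) (y : Aff F m n k) :
    ∃ x, aeval x (corner F m n hk) ≠ 0 ∧ x ∘ castIdx = y := by
  refine ⟨Function.extend castIdx y fun _ => 1, ?_, Function.extend_comp castIdx_injective _ _⟩
  rw [aeval_corner, Function.extend_apply']
  · exact one_ne_zero
  · rintro ⟨q, hq⟩
    exact (Fin.castSucc_lt_last q.1).ne (congrArg Prod.fst hq)

theorem exists_schur_eq (hk : 1 ≤ k) (y : Aff F m n k) :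
    ∃ x, aeval x (corner F m n hk) ≠ 0 ∧ schur x = y := by
  obtain ⟨x, hx, rfl⟩ := exists_comp_castIdx_eq hk y
  refine ⟨shear 1 x, by rwa [aeval_shear_corner], ?_⟩
  rw [schur_eq_shear_comp, leftInverse_shear (add_neg_cancel 1)]

theorem continuousOn_schur (hk : 1 ≤ k) :
    ContinuousOn (schur : Aff F (m + 1) (n + 1) k → Aff F m n k)
      {x | aeval x (corner F m n hk) ≠ 0} := by
  refine continuousOn_of_mem_regularOn fun q => ?_
  simp only [schur_eq_shear_comp]
  exact shear_mem_regularOn hk _ _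

theorem nonempty_preimage_comp_inter (hk : 1 ≤ k) {C : Set (Aff F m n k)} (hC : C.Nonempty) :
    ((fun x => x ∘ castIdx) ⁻¹' C ∩ {x | aeval x (corner F m n hk) ≠ 0}).Nonempty := by
  obtain ⟨y, hy⟩ := hC
  obtain ⟨x, hx, rfl⟩ := exists_comp_castIdx_eq hk y
  exact ⟨x, hy, hx⟩

theorem isIrreducible_lift [Infinite F] (hk : 1 ≤ k) {C : Set (Aff F m n k)}
    (hC : IsIrreducible C) : IsIrreducible (lift C) := by
  rw [lift_eq hk, isIrreducible_iff_closure, preimage_schur_inter_eq]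
  exact (isIrreducible_inter_of_isOpen (isIrreducible_preimage_comp castIdx_injective hC)
    (isOpen_aeval_ne_zero _) (nonempty_preimage_comp_inter hk hC.1)).image _
      ((continuousOn_of_mem_regularOn (shear_mem_regularOn hk 1)).mono Set.inter_subset_right)

theorem codim_lift [IsAlgClosed F] (hk : 1 ≤ k) {C : Set (Aff F m n k)}
    (hC : IsIrreducible C) (hCc : IsClosed C) : codim (lift C) = codim C := by
  have hinf : Infinite F := IsAlgClosed.instInfinite
  rw [lift_eq hk, preimage_schur_inter_eq,
    codim_closure_image (shear_mem_regularOn hk 1) (shear_mem_regularOn hk (-1))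
      (aeval_shear_corner hk _) (aeval_shear_corner hk _) (leftInverse_shear (add_neg_cancel 1))
      (leftInverse_shear (neg_add_cancel 1)) (isIrreducible_preimage_comp castIdx_injective hC)
      (hCc.preimage (continuous_comp_right _)) (nonempty_preimage_comp_inter hk hC.1),
    codim_preimage_comp castIdx_injective hC hCc]

/-- The preimage of `C` is already closed relative to the open set, so taking the closure adds no
points there. -/
theorem schur_mem_of_mem_lift (hk : 1 ≤ k) {C : Set (Aff F m n k)} (hC : IsClosed C)
    {x : Aff F (m + 1) (n + 1) k} (hx : x ∈ lift C) (hxc : aeval x (corner F m n hk) ≠ 0) :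
    schur x ∈ C := by
  rw [lift_eq hk] at hx
  have : x ∈ schur ⁻¹' C ∩ {x | aeval x (corner F m n hk) ≠ 0} := by
    rw [← closure_inter_subset_of_continuousOn (continuousOn_schur hk) hC]
    exact ⟨hx, hxc⟩
  exact this.1

theorem lift_mono : Monotone (lift : Set (Aff F m n k) → _) := fun _ _ h =>
  closure_mono fun _ hx => ⟨hx.1, h hx.2⟩

theorem subset_of_lift_subset_lift (hk : 1 ≤ k) {C D : Set (Aff F m n k)} (hD : IsClosed D)
    (h : lift C ⊆ lift D) : C ⊆ D := by
  intro y hy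
  obtain ⟨x, hx, rfl⟩ := exists_schur_eq hk y
  refine schur_mem_of_mem_lift hk hD (h ?_) hx
  rw [lift_eq hk]
  exact subset_closure ⟨hy, hx⟩

theorem isClosed_detVariety : IsClosed (detVariety F m n r k) := isClosed_zeroLocus _

theorem preimage_schur_detVariety_inter (hk : 1 ≤ k) :
    schur ⁻¹' detVariety F m n r k ∩ {x | aeval x (corner F m n hk) ≠ 0} =
      detVariety F (m + 1) (n + 1) (r + 1) k ∩ {x | aeval x (corner F m n hk) ≠ 0} := by
  ext x
  refine and_congr_left fun hx => schur_mem_detVariety_iff ?_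
  rwa [constantCoeff_entry hk]

theorem lift_subset_detVariety (hk : 1 ≤ k) {C : Set (Aff F m n k)}
    (hC : C ⊆ detVariety F m n r k) : lift C ⊆ detVariety F (m + 1) (n + 1) (r + 1) k := by
  refine (lift_mono hC).trans ?_
  rw [lift_eq hk, preimage_schur_detVariety_inter]
  exact closure_minimal Set.inter_subset_left isClosed_detVariety

theorem isClosed_of_mem_components {σ : Type*} {V C : Set (σ → F)} (hV : IsClosed V)
    (hC : C ∈ components V) : IsClosed C := by
  have := hC.2 ⟨closure_minimal hC.1.1 hV, hC.1.2.closure⟩ subset_closure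
  rw [subset_antisymm subset_closure this]
  exact isClosed_closure

/-- For an irreducible `W` in the variety containing `lift C`, the image under `schur` of its open
part is irreducible and contains `C`, hence is contained in `C` by maximality. The open part is
dense in `W`. -/
theorem lift_mem_components [Infinite F] (hk : 1 ≤ k) {C : Set (Aff F m n k)}
    (hC : C ∈ components (detVariety F m n r k)) :
    lift C ∈ components (detVariety F (m + 1) (n + 1) (r + 1) k) := by
  refine ⟨⟨lift_subset_detVariety hk hC.1.1, isIrreducible_lift hk hC.1.2⟩, ?_⟩
  rintro W ⟨hWZ, hW⟩ hle
  have hCW : ∀ x, schur x ∈ C → aeval x (corner F m n hk) ≠ 0 → x ∈ W := fun x hx hxc =>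
    hle (by rw [lift_eq hk]; exact subset_closure ⟨hx, hxc⟩)
  have hne : (W ∩ {x | aeval x (corner F m n hk) ≠ 0}).Nonempty := by
    obtain ⟨y, hy⟩ := hC.1.2.1
    obtain ⟨x, hx, rfl⟩ := exists_schur_eq hk y
    exact ⟨x, hCW x hy hx, hx⟩
  have himage : schur '' (W ∩ {x | aeval x (corner F m n hk) ≠ 0}) ⊆ C := by
    refine hC.2 ⟨?_, ?_⟩ fun y hy => ?_
    · rintro _ ⟨x, ⟨hx, hxc⟩, rfl⟩
      exact (preimage_schur_detVariety_inter hk).ge ⟨hWZ hx, hxc⟩ |>.1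
    · exact (isIrreducible_inter_of_isOpen hW (isOpen_aeval_ne_zero _) hne).image _
        ((continuousOn_schur hk).mono Set.inter_subset_right)
    · obtain ⟨x, hx, rfl⟩ := exists_schur_eq hk y
      exact ⟨x, ⟨hCW x hy hx, hx⟩, rfl⟩
  refine (subset_closure_inter_of_isPreirreducible_of_isOpen hW.2 (isOpen_aeval_ne_zero _)
    hne).trans ?_
  rw [lift_eq hk]
  exact closure_mono fun x hx => ⟨himage ⟨x, hx, rfl⟩, hx.2⟩

/-- The smaller variety is a finite union of irreducible closed sets, whose lifts cover the larger
one by density. The irreducible `W` lies in a single lift and equals it by maximality. The set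
lifted is a component because lifting reflects inclusions into closed sets. -/
theorem exists_lift_eq_of_mem_components [Infinite F] (hk : 1 ≤ k) (hkr : k ≤ r)
    {W : Set (Aff F (m + 1) (n + 1) k)}
    (hW : W ∈ components (detVariety F (m + 1) (n + 1) (r + 1) k)) :
    ∃ C ∈ components (detVariety F m n r k), lift C = W := by
  have := noetherianSpace_zariski (F := F) (σ := Idx m n k)
  obtain ⟨S, hSf, hSc, hSi, hSU⟩ :=
    TopologicalSpace.NoetherianSpace.exists_finite_set_isClosed_irreducible
      (isClosed_detVariety (F := F) (m := m) (n := n) (r := r) (k := k))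
  have hcover : W ⊆ ⋃₀ (lift '' S) := by
    refine hW.1.1.trans ((detVariety_subset_closure hk hkr).trans (closure_minimal ?_ ?_))
    · rw [← preimage_schur_detVariety_inter, hSU]
      rintro x ⟨⟨C, hCS, hxC⟩, hxc⟩
      refine ⟨lift C, ⟨C, hCS, rfl⟩, ?_⟩
      rw [lift_eq hk]
      exact subset_closure ⟨hxC, hxc⟩
    · rw [Set.sUnion_eq_biUnion]
      refine (hSf.image _).isClosed_biUnion ?_
      rintro _ ⟨C, -, rfl⟩
      exact isClosed_closure
  obtain ⟨_, hC, hWC⟩ := isIrreducible_iff_sUnion_isClosed.1 hW.1.2 (hSf.image lift).toFinset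
    (fun z hz => by
      obtain ⟨C, -, rfl⟩ := (hSf.image lift).mem_toFinset.1 hz
      exact isClosed_closure) (by rwa [Set.Finite.coe_toFinset])
  obtain ⟨C, hCS, rfl⟩ := (hSf.image lift).mem_toFinset.1 hC
  have hCZ : C ⊆ detVariety F m n r k := hSU ▸ Set.subset_sUnion_of_mem hCS
  have hle : ∀ D ⊆ detVariety F m n r k, IsIrreducible D → W ⊆ lift D → lift D ⊆ W :=
    fun D hD hDi h => hW.2 ⟨lift_subset_detVariety hk hD, isIrreducible_lift hk hDi⟩ h
  refine ⟨C, ⟨⟨hCZ, hSi C hCS⟩, fun D hD hCD => ?_⟩,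
    subset_antisymm (hle C hCZ (hSi C hCS) hWC) hWC⟩
  exact subset_of_lift_subset_lift hk (hSc C hCS)
    ((hle D hD.1 hD.2 (hWC.trans (lift_mono hCD))).trans hWC)

theorem bijOn_lift_components [Infinite F] (hk : 1 ≤ k) (hkr : k ≤ r) :
    Set.BijOn lift (components (detVariety F m n r k))
      (components (detVariety F (m + 1) (n + 1) (r + 1) k)) := by
  refine ⟨fun C hC => lift_mem_components hk hC, fun C hC D hD h => ?_,
    fun W hW => exists_lift_eq_of_mem_components hk hkr hW⟩
  exact subset_antisymm
    (subset_of_lift_subset_lift hk (isClosed_of_mem_components isClosed_detVariety hD) h.le)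
    (subset_of_lift_subset_lift hk (isClosed_of_mem_components isClosed_detVariety hC) h.ge)

end Lift

end TruncDet

theorem proposition6p3 {F : Type*} [Field F] [IsAlgClosed F] (m n r k : ℕ)
    (hk : 1 ≤ k) (hkr : k < r + 1) (hrm : r + 1 ≤ m + 1) (hmn : m + 1 ≤ n + 1) :
    TruncDet.detVarietyOne F (m + 1) (n + 1) (r + 1) k ⊆
        TruncDet.detVarietyZero F (m + 1) (n + 1) (r + 1) k ∧
      Set.BijOn TruncDet.lift
        (TruncDet.components (TruncDet.detVariety F m n r k))
        (TruncDet.components (TruncDet.detVariety F (m + 1) (n + 1) (r + 1) k)) ∧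
      ∀ C ∈ TruncDet.components (TruncDet.detVariety F m n r k),
        TruncDet.codim (TruncDet.lift C) = TruncDet.codim C := by
  have hinf : Infinite F := IsAlgClosed.instInfinite
  have hkr' : k ≤ r := Nat.lt_succ_iff.1 hkr
  exact ⟨fun x hx => TruncDet.detVariety_subset_detVarietyZero hk hkr' hx.1,
    TruncDet.bijOn_lift_components hk hkr', fun C hC => TruncDet.codim_lift hk hC.1.2
      (TruncDet.isClosed_of_mem_components TruncDet.isClosed_detVariety hC)⟩
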